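/- Let $\Sigma=\{x,g(x)\}$ be an alphabet of two letters, where $g(x)$ is a single formal symbol; a unary pattern with involution is a non-empty word $p\in\Sigma^*$, with length $|p|$ counted in letters of $\Sigma$. For a finite alphabet $T$, a morphic (resp. antimorphic) involution of $T^*$ is a map $g_T:T^*\to T^*$ with $g_T(g_T(u))=u$ for all $u$, and $g_T(uv)=g_T(u)g_T(v)$ (resp. $g_T(uv)=g_T(v)g_T(u)$) for all $u,v$. A word $w\in T^*$ is a morphic (resp. antimorphic) instance of $p$ if there are a morphic (resp. antimorphic) involution $g_T$ of $T^*$ and a morphism $\phi:\Sigma^*\to T^*$, sending no letter to the empty word, such that $\phi(g(x))=g_T(\phi(x))$ and $w=\phi(p)$. The morphic avoidance index $A_m(p)$ (resp. the antimorphic avoidance index $A_a(p)$) is the least size of a finite alphabet $T$ over which there is an infinite word no factor of which is a morphic (resp. antimorphic) instance of $p$; it is $\infty$ if there is no such $T$. Then for every unary pattern with involution $p$, $$A_m(p)=A_a(p)=\begin{cases} 3, & p\in\bigl(\Sigma^3\setminus\{xxx,\ g(x)g(x)g(x)\}\bigr)\cup\{xx,\ g(x)g(x)\},\\ \infty, &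 p\in\{x,\ g(x),\ xg(x),\ g(x)x\},\\ 2, & \text{otherwise.} \end{cases}$$ In particular, $A_m(p)=A_a(p)=2$ for every $p$ with $|p|\ge 4$ and for $p\in\{xxx,\ g(x)g(x)g(x)\}$. -/

import Mathlib

/-- The two-letter alphabet `Σ = {x, g(x)}`; `gx` is the single formal symbol `g(x)`. -/
inductive PatternLetter : Type
  | x : PatternLetter
  | gx : PatternLetter

/-- Unary patterns with involution: the words over `Σ = {x, g(x)}`. -/
abbrev UnaryPattern : Type := FreeMonoid PatternLetter

namespace UnaryPattern

/-- The one-letter pattern `x`. -/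
def X : UnaryPattern := FreeMonoid.of PatternLetter.x

/-- The one-letter pattern `g(x)`. -/
def G : UnaryPattern := FreeMonoid.of PatternLetter.gx

end UnaryPattern

/-- `g` is a morphic involution of the free monoid `T*`. -/
def IsMorphicInvolution {T : Type*} (g : FreeMonoid T → FreeMonoid T) : Prop :=
  (∀ u v, g (u * v) = g u * g v) ∧ Function.Involutive g

/-- `g` is an antimorphic involution of the free monoid `T*`. -/
def IsAntimorphicInvolution {T : Type*} (g : FreeMonoid T → FreeMonoid T) : Prop :=
  (∀ u v, g (u * v) = g v * g u) ∧ Function.Involutive g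

/-- A morphism between free monoids is non-erasing if no letter is sent to the empty word. -/
def IsNonErasing {S T : Type*} (φ : FreeMonoid S →* FreeMonoid T) : Prop :=
  ∀ s : S, φ (FreeMonoid.of s) ≠ 1

/-- `u = φ(p)` for a non-erasing morphism `φ : Σ* → T*` with `φ(g(x)) = g(φ(x))`. -/
def IsInstanceVia {T : Type*} (g : FreeMonoid T → FreeMonoid T) (p : UnaryPattern)
    (u : FreeMonoid T) : Prop :=
  ∃ φ : FreeMonoid PatternLetter →* FreeMonoid T,
    IsNonErasing φ ∧ φ UnaryPattern.G = g (φ UnaryPattern.X) ∧ u = φ p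

/-- `u` is a morphic instance of `p`. -/
def IsMorphicInstance {T : Type*} (p : UnaryPattern) (u : FreeMonoid T) : Prop :=
  ∃ g : FreeMonoid T → FreeMonoid T, IsMorphicInvolution g ∧ IsInstanceVia g p u

/-- `u` is an antimorphic instance of `p`. -/
def IsAntimorphicInstance {T : Type*} (p : UnaryPattern) (u : FreeMonoid T) : Prop :=
  ∃ g : FreeMonoid T → FreeMonoid T, IsAntimorphicInvolution g ∧ IsInstanceVia g p u

/-- The finite word `u` is a factor of the infinite word `w = w 0, w 1, w 2, …`:
`u = w i ⋯ w (i + n - 1)` for some position `i` and length `n`. -/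
def IsFactorOf {T : Type*} (u : FreeMonoid T) (w : ℕ → T) : Prop :=
  ∃ i n : ℕ, u = FreeMonoid.ofList ((List.range n).map fun k => w (i + k))

/-- The morphic avoidance index `A_m(p)`: the least size of a finite alphabet `T` over which there
is an infinite word with no factor that is a morphic instance of `p`; it is `⊤` (that is, `∞`)
if there is no such alphabet. -/
noncomputable def morphicAvoidanceIndex (p : UnaryPattern) : ℕ∞ :=
  sInf {c : ℕ∞ | ∃ (T : Type) (_ : Fintype T) (w : ℕ → T),
    c = (Fintype.card T : ℕ∞) ∧ ∀ u : FreeMonoid T, IsFactorOf u w → ¬ IsMorphicInstance p u}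

/-- The antimorphic avoidance index `A_a(p)`: the least size of a finite alphabet `T` over which
there is an infinite word with no factor that is an antimorphic instance of `p`; it is `⊤` (that
is, `∞`) if there is no such alphabet. -/
noncomputable def antimorphicAvoidanceIndex (p : UnaryPattern) : ℕ∞ :=
  sInf {c : ℕ∞ | ∃ (T : Type) (_ : Fintype T) (w : ℕ → T),
    c = (Fintype.card T : ℕ∞) ∧ ∀ u : FreeMonoid T, IsFactorOf u w → ¬ IsAntimorphicInstance p u}

namespace UnaryPattern

/-- The patterns `x`, `g(x)`, `x g(x)`, `g(x) x`. -/
def unavoidable : Set UnaryPattern := {X, G, X * G, G * X}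

/-- The patterns of length 3 other than `xxx` and `g(x)g(x)g(x)`, together with the two
squares `xx` and `g(x)g(x)`. -/
def indexThree : Set UnaryPattern :=
  {p | p.length = 3 ∧ p ≠ X * X * X ∧ p ≠ G * G * G} ∪ {X * X, G * G}

end UnaryPattern

/-! An involution of a free monoid preserves length (`FreeMonoid.length_eq_of_involutive`), so it is
a letter involution `σ`, followed by reversal in the antimorphic case. An instance of `p` is
therefore given by `σ` and a non-empty word `v`, and both indices become questions about
`AvoidsPattern anti`. Avoidance is invariant under exchanging `x` and `g(x)` and passes from a
pattern to every pattern containing it.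

Upper bounds: these symmetries leave only `xx`, `xxx`, `xgx` and the length-four patterns `xxgx`,
`xgxx`, `xgxg`, `xxgg`, `xggx` (`g` for `g(x)`). Cubes are avoided by the Thue–Morse word and
squares by its difference word `ternaryWord`. The others are avoided by images of `ternaryWord`
under uniform morphisms. There, instances with short `v` are excluded by a finite check over images
of square-free words (`avoids_short`). Long `v` are excluded as follows. Morphic case: if `σ = id`,
a long cube would pull back to a square in `ternaryWord`; otherwise `v` contains a marker word whose
image under `σ` never occurs. Antimorphic case: `x g(x)` is a factor of the pattern, and already the
central part of `v` followed by its reversed image does not occur.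

Lower bounds: one letter never suffices. With two letters, either a very short instance of the
pattern appears or the word alternates; an alternating word contains every pattern, because some
involution fixes `ab`. -/

/-! ### Occurrences of finite words in infinite words -/

section Occurrences

variable {T : Type*}

/-- The finite word `u` occurs in `w` at position `i`. -/
def OccursAt (w : ℕ → T) : ℕ → List T → Prop
  | _, [] => True
  | i, a :: u => w i = a ∧ OccursAt w (i + 1) u

theorem occursAt_append {w : ℕ → T} {i : ℕ} {u v : List T} :
    OccursAt w i (u ++ v) ↔ OccursAt w i u ∧ OccursAt w (i + u.length) v := by
  induction u generalizing i with
  | nil => simp [OccursAt]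
  | cons a u ih =>
    simp only [List.cons_append, OccursAt, ih, List.length_cons, and_assoc,
      show i + 1 + u.length = i + (u.length + 1) by omega]

theorem occursAt_iff_getElem? {w : ℕ → T} {i : ℕ} {u : List T} :
    OccursAt w i u ↔ ∀ k < u.length, u[k]? = some (w (i + k)) := by
  induction u generalizing i with
  | nil => simp [OccursAt]
  | cons a u ih =>
    rw [OccursAt, ih]
    constructor
    · rintro ⟨h, h'⟩ (_ | k) hk
      · simp [h]
      · have := h' k (by simpa using hk)
        simpa [show i + 1 + k = i + (k + 1) by omega] using this
    · intro h
      refine ⟨by simpa using (h 0 (by simp)).symm, fun k hk => ?_⟩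
      have := h (k + 1) (by simpa using hk)
      simpa [show i + 1 + k = i + (k + 1) by omega] using this

theorem occursAt_map_range (w : ℕ → T) (i n : ℕ) :
    OccursAt w i ((List.range n).map fun k => w (i + k)) := by
  rw [occursAt_iff_getElem?]
  intro k hk
  have : k < n := by simpa using hk
  simp [this]

theorem OccursAt.eq_map_range {w : ℕ → T} {i : ℕ} {u : List T} (h : OccursAt w i u) :
    u = (List.range u.length).map fun k => w (i + k) := by
  rw [occursAt_iff_getElem?] at h
  apply List.ext_getElem?
  intro k
  by_cases hk : k < u.length
  · rw [h k hk]; simp [hk]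
  · simp [hk]

theorem OccursAt.prefix_of_length_le {w : ℕ → T} {i : ℕ} {u v : List T} (hu : OccursAt w i u)
    (hv : OccursAt w i v) (hl : u.length ≤ v.length) : u <+: v := by
  rw [hu.eq_map_range, hv.eq_map_range]
  refine List.IsPrefix.map _ ?_
  obtain ⟨k, hk⟩ := Nat.exists_eq_add_of_le hl
  rw [hk, List.range_add]
  exact List.prefix_append _ _

theorem OccursAt.eq_of_length_eq {w : ℕ → T} {i : ℕ} {u v : List T} (hu : OccursAt w i u)
    (hv : OccursAt w i v) (hl : u.length = v.length) : u = v :=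
  (hu.prefix_of_length_le hv hl.le).eq_of_length hl

theorem OccursAt.drop {w : ℕ → T} {i : ℕ} {u : List T} (h : OccursAt w i u) {r : ℕ}
    (hr : r ≤ u.length) : OccursAt w (i + r) (u.drop r) := by
  rw [← List.take_append_drop r u, occursAt_append, List.length_take, min_eq_left hr] at h
  exact h.2

theorem OccursAt.infix {w : ℕ → T} {i : ℕ} {u v : List T} (h : OccursAt w i v) (huv : u <:+: v) :
    ∃ j, OccursAt w j u := by
  obtain ⟨a, b, rfl⟩ := huv
  rw [occursAt_append, occursAt_append] at h
  exact ⟨_, h.1.2⟩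

theorem OccursAt.shift {w : ℕ → T} {i p : ℕ} {u : List T} (h : OccursAt w i u)
    (hp : ∀ k < u.length, w (i + k) = w (i + k + p)) : OccursAt w (i + p) u := by
  rw [occursAt_iff_getElem?] at h ⊢
  intro k hk
  rw [h k hk, hp k hk, show i + p + k = i + k + p by omega]

theorem OccursAt.of_prefix {w : ℕ → T} {i : ℕ} {u v : List T} (h : OccursAt w i v) (huv : u <+: v) :
    OccursAt w i u := by
  obtain ⟨a, rfl⟩ := huv
  exact (occursAt_append.mp h).1

theorem OccursAt.periodic {w : ℕ → T} {i p : ℕ} {u : List T} (h : OccursAt w i u)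
    (h' : OccursAt w (i + p) u) {k : ℕ} (hk : k < u.length) : w (i + k) = w (i + k + p) := by
  rw [occursAt_iff_getElem?] at h h'
  have := h k hk
  rw [h' k hk] at this
  rw [add_right_comm]
  exact (Option.some_injective _ this).symm

/-- A cube of period `v.length` in `w`. -/
theorem OccursAt.periodic_of_cube {w : ℕ → T} {i : ℕ} {v : List T}
    (h : OccursAt w i (v ++ v ++ v)) {k : ℕ} (hk : k < 2 * v.length) :
    w (i + k) = w (i + k + v.length) := by
  rw [occursAt_append] at h
  have h' := occursAt_append.mp h.1
  rw [List.length_append, ← add_assoc] at h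
  exact h.1.periodic (occursAt_append.mpr ⟨h'.2, h.2⟩) (by rw [List.length_append]; omega)

theorem isFactorOf_iff {w : ℕ → T} {u : FreeMonoid T} :
    IsFactorOf u w ↔ ∃ i, OccursAt w i u.toList := by
  constructor
  · rintro ⟨i, n, rfl⟩
    exact ⟨i, occursAt_map_range w i n⟩
  · rintro ⟨i, h⟩
    exact ⟨i, u.toList.length, congrArg FreeMonoid.ofList h.eq_map_range⟩

end Occurrences

/-! ### Involutions of free monoids and instances of patterns -/

section Instances

variable {T : Type*}

/-- The action on words of a letter map `σ`: letterwise, followed by a reversal if `anti`. -/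
def letterAction (anti : Bool) (σ : T → T) (v : List T) : List T :=
  if anti then (v.map σ).reverse else v.map σ

@[simp] theorem length_letterAction (anti : Bool) (σ : T → T) (v : List T) :
    (letterAction anti σ v).length = v.length := by
  cases anti <;> simp [letterAction]

theorem letterAction_letterAction {σ : T → T} (hσ : Function.Involutive σ) (anti : Bool)
    (v : List T) : letterAction anti σ (letterAction anti σ v) = v := by
  cases anti <;> simp [letterAction, hσ.comp_self]

/-- Replace `x` by `v` and `g(x)` by `v'`. -/
def substPattern (v v' : List T) (p : List PatternLetter) : List T :=
  p.flatMap fun c => match c with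
    | .x => v
    | .gx => v'

@[simp] theorem substPattern_nil (v v' : List T) : substPattern v v' [] = [] := rfl

@[simp] theorem substPattern_x (v v' : List T) (p : List PatternLetter) :
    substPattern v v' (.x :: p) = v ++ substPattern v v' p := rfl

@[simp] theorem substPattern_gx (v v' : List T) (p : List PatternLetter) :
    substPattern v v' (.gx :: p) = v' ++ substPattern v v' p := rfl

@[simp] theorem substPattern_append (v v' : List T) (p q : List PatternLetter) :
    substPattern v v' (p ++ q) = substPattern v v' p ++ substPattern v v' q := by
  simp [substPattern]

theorem length_substPattern {v v' : List T} (h : v'.length = v.length) (p : List PatternLetter) :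
    (substPattern v v' p).length = p.length * v.length := by
  induction p with
  | nil => simp
  | cons c p ih => cases c <;> simp [ih, h] <;> ring

theorem toList_monoidHom {φ : FreeMonoid PatternLetter →* FreeMonoid T} (p : UnaryPattern) :
    (φ p).toList = substPattern (φ UnaryPattern.X).toList (φ UnaryPattern.G).toList p.toList := by
  induction p using FreeMonoid.recOn with
  | one => simp
  | of_mul c p ih =>
    rw [map_mul, FreeMonoid.toList_mul, ih, FreeMonoid.toList_of_mul]
    cases c <;> rfl

theorem FreeMonoid.exists_map_of_morphic {g : FreeMonoid T → FreeMonoid T}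
    (hmul : ∀ u v, g (u * v) = g u * g v) (hlen : ∀ a, (g (FreeMonoid.of a)).length = 1) :
    ∃ σ : T → T, ∀ u, (g u).toList = u.toList.map σ := by
  have h1 : g 1 = 1 := by
    have := hmul 1 1
    rw [mul_one] at this
    exact (mul_eq_left.mp this.symm)
  choose σ hσ using fun a => FreeMonoid.length_eq_one.mp (hlen a)
  refine ⟨σ, fun u => ?_⟩
  induction u using FreeMonoid.recOn with
  | one => simp [h1]
  | of_mul c p ih => simp [hmul, hσ, ih]

theorem FreeMonoid.exists_map_of_antimorphic {g : FreeMonoid T → FreeMonoid T}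
    (hmul : ∀ u v, g (u * v) = g v * g u) (hlen : ∀ a, (g (FreeMonoid.of a)).length = 1) :
    ∃ σ : T → T, ∀ u, (g u).toList = (u.toList.map σ).reverse := by
  have h1 : g 1 = 1 := by
    have := hmul 1 1
    rw [mul_one] at this
    exact (mul_eq_left.mp this.symm)
  choose σ hσ using fun a => FreeMonoid.length_eq_one.mp (hlen a)
  refine ⟨σ, fun u => ?_⟩
  induction u using FreeMonoid.recOn with
  | one => simp [h1]
  | of_mul c p ih => simp [hmul, hσ, ih]

/-- Since `g 1 = 1` and `g` is injective, no letter is erased, so `g` shortens no word; the same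
bound at `g u` gives equality. Assuming only additivity of lengths covers the morphic and
antimorphic cases together. -/
theorem FreeMonoid.length_eq_of_involutive {g : FreeMonoid T → FreeMonoid T}
    (hmul : ∀ u v, (g (u * v)).length = (g u).length + (g v).length)
    (hinv : Function.Involutive g) (u : FreeMonoid T) : (g u).length = u.length := by
  have h0 : (g 1).length = 0 := by
    have := hmul 1 1
    rw [mul_one] at this
    omega
  have h1 : g 1 = 1 := FreeMonoid.length_eq_zero.mp h0
  have hle : ∀ u, u.length ≤ (g u).length := by
    intro u
    induction u using FreeMonoid.recOn with
    | one => simp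
    | of_mul a u ih =>
      have : (g (FreeMonoid.of a)).length ≠ 0 := by
        intro h
        have h' : g (FreeMonoid.of a) = g 1 := by rw [h1]; exact FreeMonoid.length_eq_zero.mp h
        exact FreeMonoid.of_ne_one a (hinv.injective h')
      rw [hmul, FreeMonoid.length_mul, FreeMonoid.length_of]
      omega
  have := hle (g u)
  rw [hinv u] at this
  exact le_antisymm this (hle u)

theorem involutive_of_letterAction {g : FreeMonoid T → FreeMonoid T} {anti : Bool} {σ : T → T}
    (hinv : Function.Involutive g) (hσ : ∀ u, (g u).toList = letterAction anti σ u.toList) :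
    Function.Involutive σ := by
  intro a
  have h := congrArg FreeMonoid.toList (hinv (FreeMonoid.of a))
  rw [hσ, hσ] at h
  cases anti <;> simpa [letterAction] using h

theorem isInstanceVia_iff {g : FreeMonoid T → FreeMonoid T} {anti : Bool} {σ : T → T}
    (hσ : ∀ u, (g u).toList = letterAction anti σ u.toList) {p : UnaryPattern} {u : FreeMonoid T} :
    IsInstanceVia g p u ↔
      ∃ v ≠ [], u.toList = substPattern v (letterAction anti σ v) p.toList := by
  constructor
  · rintro ⟨φ, hne, hg, rfl⟩
    refine ⟨(φ UnaryPattern.X).toList, fun h => hne .x ?_, ?_⟩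
    · exact FreeMonoid.toList.injective h
    · rw [toList_monoidHom, hg, hσ]
  · rintro ⟨v, hv, hu⟩
    refine ⟨FreeMonoid.lift fun c => match c with
      | .x => FreeMonoid.ofList v
      | .gx => g (FreeMonoid.ofList v), ?_, ?_, ?_⟩
    · intro c h
      apply hv
      have h' := congrArg (fun u => (FreeMonoid.toList u).length) h
      cases c <;> simpa [hσ] using h'
    · simp [UnaryPattern.X, UnaryPattern.G]
    · apply FreeMonoid.toList.injective
      rw [toList_monoidHom, hu]
      simp [UnaryPattern.X, UnaryPattern.G, hσ]

theorem isMorphicInstance_iff {p : UnaryPattern} {u : FreeMonoid T} :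
    IsMorphicInstance p u ↔ ∃ σ : T → T, Function.Involutive σ ∧
      ∃ v ≠ [], u.toList = substPattern v (letterAction false σ v) p.toList := by
  constructor
  · rintro ⟨g, ⟨hmul, hinv⟩, h⟩
    obtain ⟨σ, hσ⟩ := FreeMonoid.exists_map_of_morphic hmul fun a => by
      rw [FreeMonoid.length_eq_of_involutive (fun u v => by simp [hmul]) hinv, FreeMonoid.length_of]
    have hσ' : ∀ u, (g u).toList = letterAction false σ u.toList := hσ
    exact ⟨σ, involutive_of_letterAction hinv hσ', (isInstanceVia_iff hσ').mp h⟩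
  · rintro ⟨σ, hσ, h⟩
    refine ⟨fun u => FreeMonoid.ofList (letterAction false σ u.toList), ⟨?_, ?_⟩,
      (isInstanceVia_iff fun u => rfl).mpr h⟩
    · intro u v
      apply FreeMonoid.toList.injective
      simp [letterAction]
    · intro u
      apply FreeMonoid.toList.injective
      simpa using letterAction_letterAction hσ false u.toList

theorem isAntimorphicInstance_iff {p : UnaryPattern} {u : FreeMonoid T} :
    IsAntimorphicInstance p u ↔ ∃ σ : T → T, Function.Involutive σ ∧
      ∃ v ≠ [], u.toList = substPattern v (letterAction true σ v) p.toList := by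
  constructor
  · rintro ⟨g, ⟨hmul, hinv⟩, h⟩
    obtain ⟨σ, hσ⟩ := FreeMonoid.exists_map_of_antimorphic hmul fun a => by
      rw [FreeMonoid.length_eq_of_involutive (fun u v => by simp [hmul, add_comm]) hinv,
        FreeMonoid.length_of]
    have hσ' : ∀ u, (g u).toList = letterAction true σ u.toList := hσ
    exact ⟨σ, involutive_of_letterAction hinv hσ', (isInstanceVia_iff hσ').mp h⟩
  · rintro ⟨σ, hσ, h⟩
    refine ⟨fun u => FreeMonoid.ofList (letterAction true σ u.toList), ⟨?_, ?_⟩,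
      (isInstanceVia_iff fun u => rfl).mpr h⟩
    · intro u v
      apply FreeMonoid.toList.injective
      simp [letterAction]
    · intro u
      apply FreeMonoid.toList.injective
      simpa using letterAction_letterAction hσ true u.toList

/-- No factor of `w` is an antimorphic (if `anti`) or morphic (otherwise) instance of `p`. -/
def AvoidsPattern (anti : Bool) (w : ℕ → T) (p : List PatternLetter) : Prop :=
  ∀ σ : T → T, Function.Involutive σ → ∀ v ≠ [], ∀ i,
    ¬ OccursAt w i (substPattern v (letterAction anti σ v) p)

theorem avoidsPattern_false_iff {w : ℕ → T} {p : UnaryPattern} :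
    AvoidsPattern false w p.toList ↔ ∀ u, IsFactorOf u w → ¬ IsMorphicInstance p u := by
  constructor
  · intro h u hu hi
    obtain ⟨i, hu⟩ := isFactorOf_iff.mp hu
    obtain ⟨σ, hσ, v, hv, e⟩ := isMorphicInstance_iff.mp hi
    exact h σ hσ v hv i (e ▸ hu)
  · intro h σ hσ v hv i ho
    exact h (FreeMonoid.ofList _) (isFactorOf_iff.mpr ⟨i, ho⟩)
      (isMorphicInstance_iff.mpr ⟨σ, hσ, v, hv, rfl⟩)

theorem avoidsPattern_true_iff {w : ℕ → T} {p : UnaryPattern} :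
    AvoidsPattern true w p.toList ↔ ∀ u, IsFactorOf u w → ¬ IsAntimorphicInstance p u := by
  constructor
  · intro h u hu hi
    obtain ⟨i, hu⟩ := isFactorOf_iff.mp hu
    obtain ⟨σ, hσ, v, hv, e⟩ := isAntimorphicInstance_iff.mp hi
    exact h σ hσ v hv i (e ▸ hu)
  · intro h σ hσ v hv i ho
    exact h (FreeMonoid.ofList _) (isFactorOf_iff.mpr ⟨i, ho⟩)
      (isAntimorphicInstance_iff.mpr ⟨σ, hσ, v, hv, rfl⟩)

theorem AvoidsPattern.of_infix {anti : Bool} {w : ℕ → T} {p q : List PatternLetter}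
    (h : AvoidsPattern anti w q) (hqp : q <:+: p) : AvoidsPattern anti w p := by
  obtain ⟨a, b, rfl⟩ := hqp
  intro σ hσ v hv i ho
  rw [substPattern_append, substPattern_append, occursAt_append, occursAt_append] at ho
  exact h σ hσ v hv _ ho.1.2

/-- Exchange the letters `x` and `g(x)`. -/
def PatternLetter.swap : PatternLetter → PatternLetter
  | .x => .gx
  | .gx => .x

theorem substPattern_map_swap (v v' : List T) (p : List PatternLetter) :
    substPattern v v' (p.map PatternLetter.swap) = substPattern v' v p := by
  induction p with
  | nil => rfl
  | cons c p ih => cases c <;> simp [PatternLetter.swap, ih]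

/-- Taking `g(v)` in place of `v` exchanges the two letters, because `g` is an involution. -/
theorem AvoidsPattern.map_swap {anti : Bool} {w : ℕ → T} {p : List PatternLetter}
    (h : AvoidsPattern anti w p) : AvoidsPattern anti w (p.map PatternLetter.swap) := by
  intro σ hσ v hv i ho
  rw [substPattern_map_swap] at ho
  refine h σ hσ (letterAction anti σ v) (fun e => hv ?_) i ?_
  · simpa using congrArg List.length e
  · rwa [letterAction_letterAction hσ]

end Instances

/-! ### The Thue–Morse word and a ternary square-free word -/

/-- The Thue–Morse word. -/
def thueMorse (n : ℕ) : Bool :=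
  if n = 0 then false else xor (n % 2 == 1) (thueMorse (n / 2))
decreasing_by omega

theorem thueMorse_two_mul (n : ℕ) : thueMorse (2 * n) = thueMorse n := by
  rcases Nat.eq_zero_or_pos n with rfl | hn
  · rfl
  · rw [thueMorse, if_neg (by omega), show 2 * n % 2 = 0 by omega, show 2 * n / 2 = n by omega]
    simp

theorem thueMorse_two_mul_add_one (n : ℕ) : thueMorse (2 * n + 1) = !thueMorse n := by
  rw [thueMorse, if_neg (by omega), show (2 * n + 1) % 2 = 1 by omega,
    show (2 * n + 1) / 2 = n by omega]
  simp

theorem odd_of_thueMorse_eq_succ {j : ℕ} (h : thueMorse j = thueMorse (j + 1)) : j % 2 = 1 := by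
  by_contra hj
  obtain ⟨m, rfl⟩ : ∃ m, j = 2 * m := ⟨j / 2, by omega⟩
  rw [thueMorse_two_mul, thueMorse_two_mul_add_one] at h
  cases hm : thueMorse m <;> simp [hm] at h

/-- An even period descends to half of it. For an odd period, two equal neighbours would recur at a
position of the opposite parity, while equal neighbours always start at odd positions. Hence the
factor alternates, and its letters at odd distance `p` differ. -/
theorem thueMorse_overlap_free (p : ℕ) (hp : 0 < p) (i : ℕ) :
    ¬ ∀ k ≤ p, thueMorse (i + k) = thueMorse (i + k + p) := by
  induction p using Nat.strong_induction_on generalizing i with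
  | _ p ih =>
  intro h
  rcases Nat.even_or_odd' p with ⟨q, rfl | rfl⟩
  · refine ih q (by omega) (by omega) (i / 2) fun m hm => ?_
    have := h (2 * m) (by omega)
    rcases Nat.mod_two_eq_zero_or_one i with hi | hi
    · rwa [show i + 2 * m = 2 * (i / 2 + m) by omega, ← mul_add, thueMorse_two_mul,
        thueMorse_two_mul] at this
    · rw [show i + 2 * m = 2 * (i / 2 + m) + 1 by omega, add_right_comm, ← mul_add,
        thueMorse_two_mul_add_one, thueMorse_two_mul_add_one] at this
      exact Bool.not_inj this
  · have hne : ∀ k < 2 * q + 1, thueMorse (i + k + 1) = !thueMorse (i + k) := by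
      intro k hk
      by_contra hc
      have he : thueMorse (i + k) = thueMorse (i + k + 1) := by
        revert hc
        cases thueMorse (i + k) <;> cases thueMorse (i + k + 1) <;> simp
      have h1 := odd_of_thueMorse_eq_succ he
      have ha := h k (by omega)
      have hb := h (k + 1) (by omega)
      rw [← add_assoc] at hb
      rw [ha, hb, show i + k + 1 + (2 * q + 1) = i + k + (2 * q + 1) + 1 by omega] at he
      have h2 := odd_of_thueMorse_eq_succ he
      omega
    have halt : ∀ k ≤ 2 * q + 1, thueMorse (i + k) = xor (thueMorse i) (k % 2 == 1) := by
      intro k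
      induction k with
      | zero => simp
      | succ k ihk =>
        intro hk
        rw [← add_assoc, hne k (by omega), ihk (by omega)]
        rcases Nat.mod_two_eq_zero_or_one k with hk2 | hk2
        · rw [hk2, show (k + 1) % 2 = 1 by omega]; simp
        · rw [hk2, show (k + 1) % 2 = 0 by omega]; simp
    have h0 := h 0 (by omega)
    rw [add_zero, halt _ le_rfl, show (2 * q + 1) % 2 = 1 by omega] at h0
    cases ht : thueMorse i <;> simp [ht] at h0

/-- The word over three letters that records the differences of consecutive Thue–Morse letters. -/
def ternaryWord (n : ℕ) : Fin 3 :=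
  match thueMorse n, thueMorse (n + 1) with
  | false, true => 1
  | true, false => 2
  | _, _ => 0

theorem ternaryWord_eq_iff {m n : ℕ} : ternaryWord m = ternaryWord n →
    ((thueMorse (m + 1)).toNat : ℤ) - (thueMorse m).toNat =
      (thueMorse (n + 1)).toNat - (thueMorse n).toNat := by
  unfold ternaryWord
  cases thueMorse m <;> cases thueMorse (m + 1) <;> cases thueMorse n <;>
    cases thueMorse (n + 1) <;> simp

theorem ternaryWord_square_free (p : ℕ) (hp : 0 < p) (i : ℕ) :
    ¬ ∀ k < p, ternaryWord (i + k) = ternaryWord (i + k + p) := by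
  intro h
  have hD : ∀ k ≤ p, ((thueMorse (i + k + p)).toNat : ℤ) - (thueMorse (i + k)).toNat =
      (thueMorse (i + p)).toNat - (thueMorse i).toNat := by
    intro k
    induction k with
    | zero => simp
    | succ k ih =>
      intro hk
      have := ternaryWord_eq_iff (h k (by omega))
      have := ih (by omega)
      rw [← add_assoc, add_right_comm (i + k) 1 p]
      omega
  have hpp := hD p le_rfl
  refine thueMorse_overlap_free p hp i fun k hk => ?_
  have hk' := hD k hk
  -- By `hpp` the steps from `i` to `i + p` and from `i + p` to `i + 2p` are equal; a step `±1`
  -- taken twice would leave `{0, 1}`.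
  have : ((thueMorse (i + p)).toNat : ℤ) - (thueMorse i).toNat = 0 := by
    have h1 := (thueMorse i).toNat_le
    have h2 := (thueMorse (i + p)).toNat_le
    have h3 := (thueMorse (i + p + p)).toNat_le
    omega
  rw [this] at hk'
  revert hk'
  cases thueMorse (i + k) <;> cases thueMorse (i + k + p) <;> simp

/-! ### Uniform images of the ternary square-free word -/

section UniformImage

variable {T : Type*} [Inhabited T]

/-- The image of `ternaryWord` under the `n`-uniform morphism `h`. -/
def uniformImage (h : Fin 3 → List T) (n : ℕ) (j : ℕ) : T :=
  (h (ternaryWord (j / n))).getD (j % n) default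

theorem occursAt_uniformImage_block {h : Fin 3 → List T} {n : ℕ} (hlen : ∀ a, (h a).length = n)
    (B : ℕ) : OccursAt (uniformImage h n) (n * B) (h (ternaryWord B)) := by
  rw [occursAt_iff_getElem?]
  intro k hk
  rw [hlen] at hk
  rw [uniformImage, Nat.mul_add_div (by omega), Nat.div_eq_of_lt hk, Nat.mul_add_mod,
    Nat.mod_eq_of_lt hk, add_zero, List.getD_eq_getElem?_getD,
    List.getElem?_eq_getElem (by rwa [hlen])]
  rfl

theorem occursAt_uniformImage_flatMap {h : Fin 3 → List T} {n : ℕ}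
    (hlen : ∀ a, (h a).length = n) {B : ℕ} {s : List (Fin 3)} (hs : OccursAt ternaryWord B s) :
    OccursAt (uniformImage h n) (n * B) (s.flatMap h) := by
  induction s generalizing B with
  | nil => trivial
  | cons a s ih =>
    obtain ⟨rfl, hs⟩ := hs
    rw [List.flatMap_cons, occursAt_append]
    refine ⟨occursAt_uniformImage_block hlen B, ?_⟩
    rw [hlen, ← mul_add_one]
    exact ih hs

theorem length_flatMap_of_uniform {S : Type*} {h : Fin 3 → List S} {n : ℕ} (hlen : ∀ a, (h a).length = n)
    (s : List (Fin 3)) : (s.flatMap h).length = s.length * n := by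
  induction s with
  | nil => simp
  | cons a s ih => rw [List.flatMap_cons, List.length_append, ih, hlen, List.length_cons]; ring

/-- No prefix of `s` is a non-empty square. -/
def noSquarePrefix (s : List (Fin 3)) : Bool :=
  (List.range s.length).all fun l => !(s.take (l + 1)).isPrefixOf (s.drop (l + 1))

/-- The square-free ternary words of length `M`. -/
def squareFreeWords : ℕ → List (List (Fin 3))
  | 0 => [[]]
  | M + 1 => ((squareFreeWords M).flatMap fun s => [0 :: s, 1 :: s, 2 :: s]).filter noSquarePrefix

theorem noSquarePrefix_of_occursAt {i : ℕ} {s : List (Fin 3)} (hs : OccursAt ternaryWord i s) :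
    noSquarePrefix s = true := by
  simp only [noSquarePrefix, List.all_eq_true, List.mem_range, Bool.not_eq_true',
    Bool.eq_false_iff, ne_eq, List.isPrefixOf_iff_prefix]
  intro l hl hpre
  have hlen := hpre.length_le
  simp only [List.length_take, List.length_drop] at hlen
  obtain ⟨c, hc⟩ := hpre
  rw [← List.take_append_drop (l + 1) s, ← hc, occursAt_append, occursAt_append,
    occursAt_iff_getElem?, occursAt_iff_getElem?] at hs
  have hl' : (s.take (l + 1)).length = l + 1 := by rw [List.length_take]; omega
  rw [hl'] at hs
  refine ternaryWord_square_free (l + 1) (by omega) i fun k hk => ?_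
  have h1 := hs.1 k hk
  have h2 := hs.2.1 k hk
  rw [h1] at h2
  rw [add_right_comm]
  exact Option.some_injective _ h2

/-- Soundness of the enumeration: every factor of `ternaryWord` is listed, so a check over the list
covers all positions of a uniform image. -/
theorem mem_squareFreeWords {i : ℕ} {s : List (Fin 3)} (hs : OccursAt ternaryWord i s) :
    s ∈ squareFreeWords s.length := by
  induction s generalizing i with
  | nil => simp [squareFreeWords]
  | cons a s ih =>
    rw [List.length_cons, squareFreeWords, List.mem_filter]
    refine ⟨List.mem_flatMap.mpr ⟨s, ih hs.2, ?_⟩, noSquarePrefix_of_occursAt hs⟩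
    fin_cases a <;> simp

/-- `forceList l k = k l`; evaluation computes the spine of `l` before `k` is applied. -/
def forceList {α β : Type*} : List α → (List α → β) → β
  | [], k => k []
  | a :: l, k => forceList l fun l' => k (a :: l')

theorem forceList_eq {α β : Type*} (l : List α) (k : List α → β) : forceList l k = k l := by
  induction l generalizing k with
  | nil => rfl
  | cons a l ih => rw [forceList, ih]

/-- The test `P` holds at every position in the first block of the images of the square-free words
of length `M`. -/
def allWindows (h : Fin 3 → List T) (n M : ℕ) (P : List T → Bool) : Bool :=
  (squareFreeWords M).all fun s => forceList (s.flatMap h) fun z =>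
    (List.range n).all fun r => forceList (z.drop r) P

/-- Position `i` lies at offset `i % n` of block `i / n`. Dropping fewer than `n` letters from `M +
1` blocks leaves at least `M * n + 1`, the bound used in all later criteria. -/
theorem exists_window {h : Fin 3 → List T} {n : ℕ} (hlen : ∀ a, (h a).length = n) (hn : 0 < n)
    {M : ℕ} {P : List T → Bool} (hP : allWindows h n (M + 1) P = true) (i : ℕ) :
    ∃ z, OccursAt (uniformImage h n) i z ∧ M * n < z.length ∧ P z = true := by
  have hs := occursAt_map_range ternaryWord (i / n) (M + 1)
  set s := (List.range (M + 1)).map fun k => ternaryWord (i / n + k) with hs'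
  have hsl : s.length = M + 1 := by simp [hs']
  have hmem := mem_squareFreeWords hs
  rw [hsl] at hmem
  have hr := Nat.mod_lt i hn
  have hzl := length_flatMap_of_uniform hlen s
  rw [hsl, add_one_mul] at hzl
  refine ⟨(s.flatMap h).drop (i % n), ?_, ?_, ?_⟩
  · have := (occursAt_uniformImage_flatMap hlen hs).drop (r := i % n) (by omega)
    rwa [Nat.div_add_mod] at this
  · rw [List.length_drop]; omega
  · simp only [allWindows, forceList_eq, List.all_eq_true, List.mem_range] at hP
    exact hP s hmem _ hr

/-- Images of letters occur in images of square-free words only at block boundaries. -/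
def IsSynchronizing [DecidableEq T] (h : Fin 3 → List T) (n : ℕ) : Prop :=
  ∀ a b c : Fin 3, b ≠ c → ∀ r < n, r ≠ 0 → ¬ (h a).isPrefixOf ((h b ++ h c).drop r) = true

instance [DecidableEq T] (h : Fin 3 → List T) (n : ℕ) : Decidable (IsSynchronizing h n) := by
  unfold IsSynchronizing; infer_instance

/-- A misplaced block would lie inside two consecutive blocks, which come from distinct letters
because `ternaryWord` is square-free. -/
theorem IsSynchronizing.dvd [DecidableEq T] {h : Fin 3 → List T} {n : ℕ}
    (hsync : IsSynchronizing h n) (hlen : ∀ a, (h a).length = n) (hn : 0 < n) {a : Fin 3} {j : ℕ}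
    (hj : OccursAt (uniformImage h n) j (h a)) : n ∣ j := by
  by_contra hnd
  have hr := Nat.mod_lt j hn
  have hs := occursAt_map_range ternaryWord (j / n) 2
  have hne : ternaryWord (j / n) ≠ ternaryWord (j / n + 1) := by
    intro he
    refine ternaryWord_square_free 1 one_pos (j / n) fun k hk => ?_
    obtain rfl : k = 0 := by omega
    exact he
  refine hsync a _ _ hne (j % n) hr (fun h0 => hnd (Nat.dvd_of_mod_eq_zero h0)) ?_
  have hz := (occursAt_uniformImage_flatMap hlen hs).drop (r := j % n)
    (by rw [length_flatMap_of_uniform hlen]; simp; omega)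
  rw [Nat.div_add_mod] at hz
  rw [List.isPrefixOf_iff_prefix]
  have hz' : OccursAt (uniformImage h n) j
      ((h (ternaryWord (j / n)) ++ h (ternaryWord (j / n + 1))).drop (j % n)) := by
    simpa [List.range_succ] using hz
  refine hj.prefix_of_length_le hz' ?_
  simp only [List.length_drop, List.length_append, hlen]
  omega

/-- A full block inside the cube recurs `p` later, so synchronization gives `n ∣ p`. Injectivity
then turns the repetition of `p / n` consecutive blocks into a square in `ternaryWord`. -/
theorem uniformImage_no_long_cube [DecidableEq T] {h : Fin 3 → List T} {n : ℕ}
    (hsync : IsSynchronizing h n) (hinj : Function.Injective h) (hlen : ∀ a, (h a).length = n)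
    (hn : 0 < n) {p : ℕ} (hp : n ≤ p) (i : ℕ) :
    ¬ ∀ k < 2 * p, uniformImage h n (i + k) = uniformImage h n (i + k + p) := by
  intro hper
  have hper' : ∀ j, i ≤ j → j < i + 2 * p → uniformImage h n j = uniformImage h n (j + p) := by
    intro j h1 h2
    have := hper (j - i) (by omega)
    rwa [Nat.add_sub_cancel' h1] at this
  -- `n * B` is the first block boundary at or after `i`; the fewer than `n` letters lost are made
  -- up by the second period.
  obtain ⟨B, hB1, hB2⟩ : ∃ B, i ≤ n * B ∧ n * B < i + n := by
    refine ⟨(i + n - 1) / n, ?_, ?_⟩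
    · have := Nat.div_add_mod (i + n - 1) n
      have := Nat.mod_lt (i + n - 1) hn
      omega
    · have := Nat.mul_div_le (i + n - 1) n
      omega
  have h0 := occursAt_uniformImage_block hlen B
  have hd : n ∣ n * B + p := by
    refine hsync.dvd hlen hn (h0.shift fun k hk => ?_)
    rw [hlen] at hk
    exact hper' _ (by omega) (by omega)
  obtain ⟨q, rfl⟩ := (Nat.dvd_add_right (Dvd.intro B rfl)).mp hd
  have hq : 0 < q := by
    rcases Nat.eq_zero_or_pos q with rfl | hq
    · omega
    · exact hq
  refine ternaryWord_square_free q hq B fun m hm => hinj ?_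
  have hm' : n * m + n ≤ n * q := by rw [← mul_add_one]; exact Nat.mul_le_mul_left n hm
  have h1 := (occursAt_uniformImage_block hlen (B + m)).shift (p := n * q) fun k hk => by
    rw [hlen] at hk
    rw [mul_add]
    exact hper' _ (by omega) (by omega)
  rw [← mul_add] at h1
  exact h1.eq_of_length_eq (occursAt_uniformImage_block hlen (B + m + q)) (by rw [hlen, hlen])

end UniformImage

/-! ### Criteria for uniform images to avoid patterns -/

section Criteria

variable {T : Type*} [DecidableEq T]

/-- Remove from `z` a prefix equal to the image under `σ` of the first `l` letters of `u`, and apply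
`k` to the rest; `false` if there is no such prefix. Written with recursors, which makes evaluation
fast. -/
noncomputable def consumePrefix (σ : T → T) (l : ℕ) (u : List T) (k : List T → Bool)
    (z : List T) : Bool :=
  Nat.rec (motive := fun _ => List T → List T → Bool) (fun _ z => k z)
    (fun _ ih u z => List.rec (motive := fun _ => Bool) false
      (fun a u' _ => List.rec (motive := fun _ => Bool) false
        (fun b z' _ => Bool.rec false (ih u' z') (σ a == b)) z) u) l u z

theorem consumePrefix_append (σ : T → T) (v r z : List T) (k : List T → Bool) :
    consumePrefix σ v.length (v ++ r) k (v.map σ ++ z) = k z := by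
  induction v with
  | nil => rfl
  | cons a v ih =>
    change Bool.rec false (consumePrefix σ v.length (v ++ r) k (v.map σ ++ z)) (σ a == σ a) = k z
    rw [beq_self_eq_true]
    exact ih

/-- `z` begins with the word obtained from `p` by replacing `x` by the first `l` letters of `u` and
`g(x)` by the image under `σ` of the first `l` letters of `u'`. -/
noncomputable def beginsWith (σ : T → T) (l : ℕ) (u u' : List T) (p : List PatternLetter)
    (z : List T) : Bool :=
  p.foldr (fun c => match c with
    | .x => consumePrefix id l u
    | .gx => consumePrefix σ l u') (fun _ => true) z

/-- With `v' = v` this serves the morphic case, with `v' = v.reverse` the antimorphic one. The tails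
`r`, `r'` allow testing against an uncut list. -/
theorem beginsWith_substPattern (σ : T → T) {v v' : List T} (hv : v'.length = v.length)
    (r r' z : List T) (p : List PatternLetter) :
    beginsWith σ v.length (v ++ r) (v' ++ r') p (substPattern v (v'.map σ) p ++ z) = true := by
  induction p with
  | nil => rfl
  | cons c p ih =>
    cases c with
    | x =>
      have := consumePrefix_append id v r (substPattern v (v'.map σ) p ++ z)
        (beginsWith σ v.length (v ++ r) (v' ++ r') p)
      rw [List.map_id] at this
      rw [substPattern_x, List.append_assoc]
      exact this.trans ih
    | gx =>
      have := consumePrefix_append σ v' r' (substPattern v (v'.map σ) p ++ z)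
        (beginsWith σ v.length (v ++ r) (v' ++ r') p)
      rw [hv] at this
      rw [substPattern_gx, List.append_assoc]
      exact this.trans ih

/-- `P l v.reverse z'` holds for all decompositions `z = v ++ z'` with `1 ≤ l = v.length ≤ n`, when
started with `l = 0` and `ru = []`. -/
def allSplits {S : Type*} (P : ℕ → List S → List S → Bool) : ℕ → ℕ → List S → List S → Bool
  | n + 1, l, ru, a :: z => P (l + 1) (a :: ru) z && allSplits P n (l + 1) (a :: ru) z
  | _, _, _, _ => true

theorem allSplits_append {S : Type*} {P : ℕ → List S → List S → Bool} {n l : ℕ} {ru v z : List S}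
    (h : allSplits P n l ru (v ++ z) = true) (hv : v ≠ []) (hn : v.length ≤ n) :
    P (l + v.length) (v.reverse ++ ru) z = true := by
  induction v generalizing n l ru with
  | nil => exact absurd rfl hv
  | cons a v ih =>
    obtain ⟨n, rfl⟩ := Nat.exists_eq_add_of_le' (Nat.one_le_of_lt (by simpa using hn))
    rw [List.cons_append, allSplits, Bool.and_eq_true] at h
    rcases eq_or_ne v [] with rfl | hne
    · simpa using h.1
    · have := ih h.2 hne (by simpa using hn)
      rw [List.length_cons, List.reverse_cons, List.append_assoc, List.singleton_append,
        show l + (v.length + 1) = l + 1 + v.length by omega]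
      exact this

/-- `z` has no prefix that is an instance of `x p` given by a letter map in `maps` and a non-empty
word of length at most `L`. -/
noncomputable def noShortInstance (anti : Bool) (maps : List (T → T)) (L : ℕ)
    (p : List PatternLetter) (z : List T) : Bool :=
  maps.all fun σ => allSplits (fun l ru z' =>
    !beginsWith σ l z (bif anti then ru else z) p z') L 0 [] z

/-- `z` does not begin with `v` followed by its reversed image under a letter map in `maps`, where
`v` has length `L`. -/
def noReversedPair (maps : List (T → T)) (L : ℕ) (z : List T) : Bool :=
  maps.all fun σ => !(z.take L ++ ((z.take L).map σ).reverse).isPrefixOf z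

/-- Some word in `markers` occurs among the first `L` letters of `z`. -/
def hasMarker (markers : List (List T)) (L : ℕ) (z : List T) : Bool :=
  markers.any fun m => (List.range L).any fun j => m.isPrefixOf ((z.take L).drop j)

/-- `z` does not begin with the image of a word in `markers` under a letter map in `maps`. -/
def noMarkerImage (markers : List (List T)) (maps : List (T → T)) (z : List T) : Bool :=
  markers.all fun m => maps.all fun σ => !(m.map σ).isPrefixOf z

variable [Inhabited T]

theorem avoids_short {h : Fin 3 → List T} {n M L : ℕ} {anti : Bool} {maps : List (T → T)}
    {p : List PatternLetter} (hlen : ∀ a, (h a).length = n) (hn : 0 < n)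
    (hM : (p.length + 1) * L ≤ M * n + 1)
    (hP : allWindows h n (M + 1) (noShortInstance anti maps L p) = true)
    {σ : T → T} (hσ : σ ∈ maps) {v : List T} (hv : v ≠ []) (hvL : v.length ≤ L) (i : ℕ) :
    ¬ OccursAt (uniformImage h n) i (substPattern v (letterAction anti σ v) (.x :: p)) := by
  intro ho
  obtain ⟨z, hz, hzl, hPz⟩ := exists_window hlen hn hP i
  have hl : (substPattern v (letterAction anti σ v) (.x :: p)).length ≤ z.length := by
    rw [length_substPattern (length_letterAction anti σ v), List.length_cons]
    have : (p.length + 1) * v.length ≤ (p.length + 1) * L := Nat.mul_le_mul_left _ hvL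
    omega
  obtain ⟨r, rfl⟩ := ho.prefix_of_length_le hz hl
  simp only [noShortInstance, List.all_eq_true] at hPz
  have h := hPz σ hσ
  rw [substPattern_x, List.append_assoc] at h
  have h' := allSplits_append h hv hvL
  rw [zero_add, List.append_nil] at h'
  cases anti
  · have := beginsWith_substPattern σ (v := v) rfl
      (substPattern v (v.map σ) p ++ r) (substPattern v (v.map σ) p ++ r) r p
    simp [letterAction, this] at h'
  · have := beginsWith_substPattern σ (v := v) (List.length_reverse)
      (substPattern v (v.map σ).reverse p ++ r) [] r p
    rw [List.map_reverse, List.append_nil] at this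
    simp [letterAction, this] at h'

/-- A uniform image avoids `x p` morphically if it has no short instances, it has no long cubes,
and long factors contain markers whose images under non-trivial letter maps do not occur. -/
theorem avoidsPattern_false_of_checks {h : Fin 3 → List T} {n M N L : ℕ} {maps : List (T → T)}
    {markers : List (List T)} {p : List PatternLetter}
    (hmaps : ∀ σ : T → T, Function.Involutive σ → σ = id ∨ σ ∈ maps)
    (hlen : ∀ a, (h a).length = n) (hn : 0 < n) (hinj : Function.Injective h)
    (hsync : IsSynchronizing h n) (hnL : n ≤ L) (hNL : L ≤ N * n + 1)
    (hp : 2 ≤ p.length) (hG : .gx ∈ p)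
    (hM : (p.length + 1) * L ≤ M * n + 1)
    (hshort : allWindows h n (M + 1) (noShortInstance false (id :: maps) L p) = true)
    (hmark : allWindows h n (N + 1) (hasMarker markers L) = true)
    (himage : allWindows h n (N + 1) (noMarkerImage markers maps) = true)
    (hmL : ∀ m ∈ markers, m.length ≤ L) :
    AvoidsPattern false (uniformImage h n) (.x :: p) := by
  intro σ hσ v hv i ho
  by_cases hvL : v.length ≤ L
  · exact avoids_short hlen hn hM hshort (by simpa using hmaps σ hσ) hv hvL i ho
  rw [not_le] at hvL
  rcases hmaps σ hσ with rfl | hmem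
  -- For `σ = id` the instance is a power of `v` with exponent at least 3, hence contains a cube of
  -- period greater than `L ≥ n`.
  · have hall : ∀ q : List PatternLetter, substPattern v (letterAction false id v) q =
        (List.replicate q.length v).flatten := by
      intro q
      induction q with
      | nil => rfl
      | cons c q ih =>
        rw [letterAction, if_neg Bool.false_ne_true, List.map_id] at ih ⊢
        cases c <;> simp [List.replicate_succ, ih]
    rw [hall, List.length_cons, List.replicate_succ, List.flatten_cons] at ho
    obtain ⟨k, hk⟩ := Nat.exists_eq_add_of_le' hp
    rw [hk, List.replicate_succ, List.replicate_succ, List.flatten_cons, List.flatten_cons,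
      ← List.append_assoc, ← List.append_assoc, occursAt_append] at ho
    exact uniformImage_no_long_cube hsync hinj hlen hn (hnL.trans hvL.le) i fun k hk =>
      ho.1.periodic_of_cube hk
  -- For non-trivial `σ`, both `v` and `v.map σ` occur; `v` contains a marker, so the forbidden
  -- `σ`-image of that marker occurs.
  · have hX : OccursAt (uniformImage h n) i v := by
      rw [substPattern_x, occursAt_append] at ho
      exact ho.1
    obtain ⟨j, hG⟩ : ∃ j, OccursAt (uniformImage h n) j (v.map σ) := by
      obtain ⟨a, b, rfl⟩ := List.append_of_mem hG
      refine ho.infix (u := v.map σ) ⟨v ++ substPattern v (v.map σ) a, substPattern v (v.map σ) b, ?_⟩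
      simp [letterAction]
    obtain ⟨z, hz, hzl, hPz⟩ := exists_window hlen hn hmark i
    simp only [hasMarker, List.any_eq_true, List.mem_range] at hPz
    obtain ⟨m, hm, l, hl, hpre⟩ := hPz
    rw [List.isPrefixOf_iff_prefix] at hpre
    have hvz : z.take L <+: v :=
      OccursAt.prefix_of_length_le (w := uniformImage h n) (i := i)
        (hz.of_prefix (List.take_prefix _ _)) hX (by rw [List.length_take]; omega)
    have hmv : m <:+: v :=
      (hpre.isInfix.trans (List.drop_suffix l _).isInfix).trans hvz.isInfix
    obtain ⟨j', hj'⟩ := hG.infix (hmv.map σ)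
    obtain ⟨z', hz', hzl', hPz'⟩ := exists_window hlen hn himage j'
    simp only [noMarkerImage, List.all_eq_true] at hPz'
    have hpre' := hj'.prefix_of_length_le hz' (by
      rw [List.length_map]; have := hmL m hm; omega)
    have := hPz' m hm σ hmem
    rw [List.isPrefixOf_iff_prefix.mpr hpre'] at this
    simp at this

/-- If `b` is the suffix of `v` of length `L`, the centre of the word is `b` followed by its
reversed image, so checking the single length `L` settles all longer ones. -/
theorem not_occursAt_reversed_pair {h : Fin 3 → List T} {n M L : ℕ} {maps : List (T → T)}
    (hlen : ∀ a, (h a).length = n) (hn : 0 < n)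
    (hM : 2 * L ≤ M * n + 1) (hpair : allWindows h n (M + 1) (noReversedPair maps L) = true)
    {σ : T → T} (hσ : σ ∈ maps) {v : List T} (hv : L ≤ v.length) (i : ℕ) :
    ¬ OccursAt (uniformImage h n) i (v ++ (v.map σ).reverse) := by
  intro ho
  obtain ⟨a, b, rfl, hb⟩ : ∃ a b, v = a ++ b ∧ b.length = L :=
    ⟨v.take (v.length - L), v.drop (v.length - L), by simp, by simp; omega⟩
  obtain ⟨j, hj⟩ := ho.infix (u := b ++ (b.map σ).reverse) ⟨a, (a.map σ).reverse, by simp⟩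
  obtain ⟨z, hz, hzl, hPz⟩ := exists_window hlen hn hpair j
  have hpre := hj.prefix_of_length_le hz (by simp; omega)
  have htake : z.take L = b := by
    rw [← hb]
    exact (List.prefix_iff_eq_take.mp ((List.prefix_append _ _).trans hpre)).symm
  simp only [noReversedPair, List.all_eq_true] at hPz
  have := hPz σ hσ
  rw [htake, List.isPrefixOf_iff_prefix.mpr hpre] at this
  simp at this

/-- A uniform image avoids `x p` antimorphically if it has no short instances and no long words
followed by a reversed image of themselves. -/
theorem avoidsPattern_true_of_checks {h : Fin 3 → List T} {n M N L K : ℕ} {maps : List (T → T)}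
    {p : List PatternLetter} (hmaps : ∀ σ : T → T, Function.Involutive σ → σ = id ∨ σ ∈ maps)
    (hlen : ∀ a, (h a).length = n) (hn : 0 < n)
    (hK : 2 * K ≤ N * n + 1) (hKL : K ≤ L) (hG : .gx ∈ p)
    (hM : (p.length + 1) * L ≤ M * n + 1)
    (hshort : allWindows h n (M + 1) (noShortInstance true (id :: maps) L p) = true)
    (hpair : allWindows h n (N + 1) (noReversedPair (id :: maps) K) = true) :
    AvoidsPattern true (uniformImage h n) (.x :: p) := by
  intro σ hσ v hv i ho
  have hmem : σ ∈ id :: maps := by simpa using hmaps σ hσ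
  by_cases hvL : v.length ≤ L
  · exact avoids_short hlen hn hM hshort hmem hv hvL i ho
  -- The pattern starts with `x`, so its first `g(x)` is preceded by `x`.
  obtain ⟨a, b, hab⟩ : ∃ a b, .x :: p = a ++ [.x, .gx] ++ b := by
    clear * - hG
    induction p with
    | nil => simp at hG
    | cons c p ih =>
      cases c with
      | gx => exact ⟨[], p, rfl⟩
      | x =>
        obtain ⟨a, b, h⟩ := ih (by simpa using hG)
        exact ⟨.x :: a, b, by rw [h]; rfl⟩
  rw [hab] at ho
  obtain ⟨j, hj⟩ := ho.infix (u := v ++ (v.map σ).reverse) ⟨substPattern v _ a, substPattern v _ b, by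
    simp [letterAction]; rfl⟩
  exact not_occursAt_reversed_pair hlen hn hK hpair hmem (by omega) j hj

end Criteria

/-! ### Words avoiding the minimal patterns -/

section ConcreteWords

theorem bool_involutive (σ : Bool → Bool) (hσ : Function.Involutive σ) :
    σ = id ∨ σ ∈ [not] := by
  revert σ
  unfold Function.Involutive
  decide

theorem fin_three_involutive (σ : Fin 3 → Fin 3) (hσ : Function.Involutive σ) :
    σ = id ∨ σ ∈ [![1, 0, 2], ![2, 1, 0], ![0, 2, 1]] := by
  revert σ
  unfold Function.Involutive
  decide +kernel

/-- Binary blocks all of whose inner runs have length 2 or 3. -/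
def longRunBlocks : Fin 3 → List Bool :=
  ![[false, false, true, true, false, false, false, true, true, false, false, false, true,
     true, true, false],
    [false, false, true, true, true, false, false, true, true, false, false, false, true,
     true, true, false],
    [false, true, true, false, false, true, true, false, false, true, true, true, false,
     false, true, true]]

/-- Words whose images under non-trivial letter involutions do not occur in the image of
`ternaryWord` under `longRunBlocks`. -/
def longRunMarkers : List (List Bool) :=
  [[true, true, true, false, false, true, true, false, false],
   [false, false, false, true, true, false, false, false, true],
   [false, true, true, false, false, false, true, true, true],
   [false, true, true, true, false, false, true, true, false]]

theorem length_longRunBlocks (a : Fin 3) : (longRunBlocks a).length = 16 := by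
  revert a; decide

theorem longRunBlocks_injective : Function.Injective longRunBlocks := by
  unfold Function.Injective; decide

theorem longRunBlocks_synchronizing : IsSynchronizing longRunBlocks 16 := by
  decide +kernel

theorem longRunBlocks_hasMarker :
    allWindows longRunBlocks 16 3 (hasMarker longRunMarkers 20) = true := by
  decide +kernel

theorem longRunBlocks_noMarkerImage :
    allWindows longRunBlocks 16 3 (noMarkerImage longRunMarkers [not]) = true := by
  decide +kernel

theorem longRunBlocks_noReversedPair :
    allWindows longRunBlocks 16 3 (noReversedPair (id :: [not]) 14) = true := by
  decide +kernel

theorem longRunBlocks_noShortInstance_xxgx (anti : Bool) :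
    allWindows longRunBlocks 16 6
      (noShortInstance anti (id :: [not]) 20 [.x, .gx, .x]) = true := by
  cases anti <;> decide +kernel

/-- All runs in this image have length 2 or 3, which rules out `aaaa` and `aaba`, the instances with
a single letter for `x`. -/
theorem avoidsPattern_xxgx (anti : Bool) :
    AvoidsPattern anti (uniformImage longRunBlocks 16) [.x, .x, .gx, .x] := by
  cases anti
  -- Four copies of at most 20 letters fit a window: `4 * 20 ≤ 5 * 16 + 1`.
  · exact avoidsPattern_false_of_checks (M := 5) (N := 2) (L := 20) (p := [.x, .gx, .x])
      bool_involutive length_longRunBlocks (by norm_num) longRunBlocks_injective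
      longRunBlocks_synchronizing (by norm_num) (by norm_num) (by simp) (by simp) (by simp)
      (longRunBlocks_noShortInstance_xxgx false) longRunBlocks_hasMarker
      longRunBlocks_noMarkerImage (by decide)
  · exact avoidsPattern_true_of_checks (M := 5) (N := 2) (L := 20) (K := 14) (p := [.x, .gx, .x])
      bool_involutive length_longRunBlocks (by norm_num) (by norm_num) (by norm_num)
      (by simp) (by simp) (longRunBlocks_noShortInstance_xxgx true)
      longRunBlocks_noReversedPair

theorem longRunBlocks_noShortInstance_xgxx (anti : Bool) :
    allWindows longRunBlocks 16 6
      (noShortInstance anti (id :: [not]) 20 [.gx, .x, .x]) = true := by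
  cases anti <;> decide +kernel

theorem avoidsPattern_xgxx (anti : Bool) :
    AvoidsPattern anti (uniformImage longRunBlocks 16) [.x, .gx, .x, .x] := by
  cases anti
  · exact avoidsPattern_false_of_checks (M := 5) (N := 2) (L := 20) (p := [.gx, .x, .x])
      bool_involutive length_longRunBlocks (by norm_num) longRunBlocks_injective
      longRunBlocks_synchronizing (by norm_num) (by norm_num) (by simp) (by simp) (by simp)
      (longRunBlocks_noShortInstance_xgxx false) longRunBlocks_hasMarker
      longRunBlocks_noMarkerImage (by decide)
  · exact avoidsPattern_true_of_checks (M := 5) (N := 2) (L := 20) (K := 14) (p := [.gx, .x, .x])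
      bool_involutive length_longRunBlocks (by norm_num) (by norm_num) (by norm_num)
      (by simp) (by simp) (longRunBlocks_noShortInstance_xgxx true)
      longRunBlocks_noReversedPair

/-- Binary blocks whose images of square-free words avoid `0101` and `1010`. -/
def alternationFreeBlocks : Fin 3 → List Bool :=
  ![[false, false, false, true, false, false, true, true],
    [false, false, false, true, true, false, false, true],
    [false, false, false, true, true, false, true, true]]

/-- Words whose images under non-trivial letter involutions do not occur in the image of
`ternaryWord` under `alternationFreeBlocks`. -/
def alternationFreeMarkers : List (List Bool) :=
  [[false, false, false]]

theorem length_alternationFreeBlocks (a : Fin 3) : (alternationFreeBlocks a).length = 8 := by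
  revert a; decide

theorem alternationFreeBlocks_injective : Function.Injective alternationFreeBlocks := by
  unfold Function.Injective; decide

theorem alternationFreeBlocks_synchronizing : IsSynchronizing alternationFreeBlocks 8 := by
  decide +kernel

theorem alternationFreeBlocks_hasMarker :
    allWindows alternationFreeBlocks 8 3 (hasMarker alternationFreeMarkers 10) = true := by
  decide +kernel

theorem alternationFreeBlocks_noMarkerImage :
    allWindows alternationFreeBlocks 8 3 (noMarkerImage alternationFreeMarkers [not]) = true := by
  decide +kernel

theorem alternationFreeBlocks_noReversedPair :
    allWindows alternationFreeBlocks 8 3 (noReversedPair (id :: [not]) 6) = true := by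
  decide +kernel

theorem alternationFreeBlocks_noShortInstance_xgxg (anti : Bool) :
    allWindows alternationFreeBlocks 8 6
      (noShortInstance anti (id :: [not]) 10 [.gx, .x, .gx]) = true := by
  cases anti <;> decide +kernel

theorem avoidsPattern_xgxg (anti : Bool) :
    AvoidsPattern anti (uniformImage alternationFreeBlocks 8) [.x, .gx, .x, .gx] := by
  cases anti
  · exact avoidsPattern_false_of_checks (M := 5) (N := 2) (L := 10) (p := [.gx, .x, .gx])
      bool_involutive length_alternationFreeBlocks (by norm_num) alternationFreeBlocks_injective
      alternationFreeBlocks_synchronizing (by norm_num) (by norm_num) (by simp) (by simp) (by simp)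
      (alternationFreeBlocks_noShortInstance_xgxg false) alternationFreeBlocks_hasMarker
      alternationFreeBlocks_noMarkerImage (by decide)
  · exact avoidsPattern_true_of_checks (M := 5) (N := 2) (L := 10) (K := 6) (p := [.gx, .x, .gx])
      bool_involutive length_alternationFreeBlocks (by norm_num) (by norm_num) (by norm_num)
      (by simp) (by simp) (alternationFreeBlocks_noShortInstance_xgxg true)
      alternationFreeBlocks_noReversedPair

/-- Binary blocks in which ones are isolated and runs of zeros are odd. -/
def sparseBlocks : Fin 3 → List Bool :=
  ![[false, false, false, true, false, false, false, true, false, true, false, true, false,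
     false, false, true],
    [false, true, false, false, false, true, false, false, false, true, false, true, false,
     false, false, true],
    [false, true, false, true, false, false, false, true, false, true, false, false, false,
     true, false, true]]

/-- Words whose images under non-trivial letter involutions do not occur in the image of
`ternaryWord` under `sparseBlocks`. -/
def sparseMarkers : List (List Bool) :=
  [[false, false]]

theorem length_sparseBlocks (a : Fin 3) : (sparseBlocks a).length = 16 := by
  revert a; decide

theorem sparseBlocks_injective : Function.Injective sparseBlocks := by
  unfold Function.Injective; decide

theorem sparseBlocks_synchronizing : IsSynchronizing sparseBlocks 16 := by
  decide +kernel

theorem sparseBlocks_hasMarker :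
    allWindows sparseBlocks 16 2 (hasMarker sparseMarkers 16) = true := by
  decide +kernel

theorem sparseBlocks_noMarkerImage :
    allWindows sparseBlocks 16 2 (noMarkerImage sparseMarkers [not]) = true := by
  decide +kernel

theorem sparseBlocks_noReversedPair :
    allWindows sparseBlocks 16 2 (noReversedPair (id :: [not]) 6) = true := by
  decide +kernel

theorem sparseBlocks_noShortInstance_xxgg (anti : Bool) :
    allWindows sparseBlocks 16 5
      (noShortInstance anti (id :: [not]) 16 [.x, .gx, .gx]) = true := by
  cases anti <;> decide +kernel

theorem avoidsPattern_xxgg (anti : Bool) :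
    AvoidsPattern anti (uniformImage sparseBlocks 16) [.x, .x, .gx, .gx] := by
  cases anti
  · exact avoidsPattern_false_of_checks (M := 4) (N := 1) (L := 16) (p := [.x, .gx, .gx])
      bool_involutive length_sparseBlocks (by norm_num) sparseBlocks_injective
      sparseBlocks_synchronizing (by norm_num) (by norm_num) (by simp) (by simp) (by simp)
      (sparseBlocks_noShortInstance_xxgg false) sparseBlocks_hasMarker
      sparseBlocks_noMarkerImage (by decide)
  · exact avoidsPattern_true_of_checks (M := 4) (N := 1) (L := 16) (K := 6) (p := [.x, .gx, .gx])
      bool_involutive length_sparseBlocks (by norm_num) (by norm_num) (by norm_num)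
      (by simp) (by simp) (sparseBlocks_noShortInstance_xxgg true)
      sparseBlocks_noReversedPair

theorem sparseBlocks_noShortInstance_xggx (anti : Bool) :
    allWindows sparseBlocks 16 5
      (noShortInstance anti (id :: [not]) 16 [.gx, .gx, .x]) = true := by
  cases anti <;> decide +kernel

theorem avoidsPattern_xggx (anti : Bool) :
    AvoidsPattern anti (uniformImage sparseBlocks 16) [.x, .gx, .gx, .x] := by
  cases anti
  · exact avoidsPattern_false_of_checks (M := 4) (N := 1) (L := 16) (p := [.gx, .gx, .x])
      bool_involutive length_sparseBlocks (by norm_num) sparseBlocks_injective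
      sparseBlocks_synchronizing (by norm_num) (by norm_num) (by simp) (by simp) (by simp)
      (sparseBlocks_noShortInstance_xggx false) sparseBlocks_hasMarker
      sparseBlocks_noMarkerImage (by decide)
  · exact avoidsPattern_true_of_checks (M := 4) (N := 1) (L := 16) (K := 6) (p := [.gx, .gx, .x])
      bool_involutive length_sparseBlocks (by norm_num) (by norm_num) (by norm_num)
      (by simp) (by simp) (sparseBlocks_noShortInstance_xggx true)
      sparseBlocks_noReversedPair

/-- Ternary blocks whose images of square-free words have no factor `aba`. -/
def ternaryBlocks : Fin 3 → List (Fin 3) :=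
  ![[0, 0, 1, 1, 0, 2],
    [1, 0, 2, 1, 1, 2],
    [2, 0, 0, 1, 2, 2]]

/-- Words whose images under non-trivial letter involutions do not occur in the image of
`ternaryWord` under `ternaryBlocks`. -/
def ternaryMarkers : List (List (Fin 3)) :=
  [[2, 0, 0, 1],
   [1, 0, 2, 1],
   [2, 2, 0, 0],
   [2, 1, 0, 2],
   [0, 0, 1, 1]]

theorem length_ternaryBlocks (a : Fin 3) : (ternaryBlocks a).length = 6 := by
  revert a; decide

theorem ternaryBlocks_injective : Function.Injective ternaryBlocks := by
  unfold Function.Injective; decide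

theorem ternaryBlocks_synchronizing : IsSynchronizing ternaryBlocks 6 := by
  decide +kernel

theorem ternaryBlocks_hasMarker :
    allWindows ternaryBlocks 6 3 (hasMarker ternaryMarkers 8) = true := by
  decide +kernel

theorem ternaryBlocks_noMarkerImage :
    allWindows ternaryBlocks 6 3
      (noMarkerImage ternaryMarkers [![1, 0, 2], ![2, 1, 0], ![0, 2, 1]]) = true := by
  decide +kernel

theorem ternaryBlocks_noReversedPair :
    allWindows ternaryBlocks 6 3
      (noReversedPair (id :: [![1, 0, 2], ![2, 1, 0], ![0, 2, 1]]) 5) = true := by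
  decide +kernel

theorem ternaryBlocks_noShortInstance_xgx (anti : Bool) :
    allWindows ternaryBlocks 6 5
      (noShortInstance anti (id :: [![1, 0, 2], ![2, 1, 0], ![0, 2, 1]]) 8 [.gx, .x]) = true := by
  cases anti <;> decide +kernel

theorem avoidsPattern_xgx (anti : Bool) :
    AvoidsPattern anti (uniformImage ternaryBlocks 6) [.x, .gx, .x] := by
  cases anti
  · exact avoidsPattern_false_of_checks (M := 4) (N := 2) (L := 8) (p := [.gx, .x])
      fin_three_involutive length_ternaryBlocks (by norm_num) ternaryBlocks_injective
      ternaryBlocks_synchronizing (by norm_num) (by norm_num) (by simp) (by simp) (by simp)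
      (ternaryBlocks_noShortInstance_xgx false) ternaryBlocks_hasMarker
      ternaryBlocks_noMarkerImage (by decide)
  · exact avoidsPattern_true_of_checks (M := 4) (N := 2) (L := 8) (K := 5) (p := [.gx, .x])
      fin_three_involutive length_ternaryBlocks (by norm_num) (by norm_num) (by norm_num)
      (by simp) (by simp) (ternaryBlocks_noShortInstance_xgx true)
      ternaryBlocks_noReversedPair

end ConcreteWords

/-! ### Patterns that cannot be avoided over small alphabets -/

section LowerBounds

variable {T : Type*}

theorem not_avoidsPattern_single (anti : Bool) (w : ℕ → T) : ¬ AvoidsPattern anti w [.x] :=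
  fun h => h id (fun _ => rfl) [w 0] (by simp) 0 (by simp [OccursAt])

theorem not_avoidsPattern_x_gx (anti : Bool) (w : ℕ → T) : ¬ AvoidsPattern anti w [.x, .gx] := by
  classical
  intro h
  refine h (Equiv.swap (w 0) (w 1)) (fun a => Equiv.swap_apply_self _ _ a) [w 0] (by simp) 0 ?_
  cases anti <;> simp [OccursAt, letterAction]

theorem not_avoidsPattern_of_subsingleton [Subsingleton T] (anti : Bool) (w : ℕ → T)
    (p : List PatternLetter) : ¬ AvoidsPattern anti w p := by
  have hocc : ∀ (u : List T) (i : ℕ), OccursAt w i u := by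
    intro u
    induction u with
    | nil => exact fun _ => trivial
    | cons a u ih => exact fun i => ⟨Subsingleton.elim _ _, ih _⟩
  exact fun h => h id (fun _ => rfl) [w 0] (by simp) 0 (hocc _ _)

/-- With `v = ab` fixed by the involution, every pattern becomes a power of `ab`, and so occurs in
an alternating word. -/
theorem exists_letterAction_pair_eq (anti : Bool) (a b : T) :
    ∃ σ : T → T, Function.Involutive σ ∧ letterAction anti σ [a, b] = [a, b] := by
  classical
  cases anti
  · exact ⟨id, fun _ => rfl, by simp [letterAction]⟩
  · exact ⟨Equiv.swap a b, fun c => Equiv.swap_apply_self _ _ c, by simp [letterAction]⟩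

theorem occursAt_alternating {w : ℕ → T} (h : ∀ i, w (i + 2) = w i) (i : ℕ)
    (p : List PatternLetter) (hi : i % 2 = 0) :
    OccursAt w i (substPattern [w 0, w 1] [w 0, w 1] p) := by
  have hw : ∀ k, w (2 * k) = w 0 ∧ w (2 * k + 1) = w 1 := by
    intro k
    induction k with
    | zero => simp
    | succ k ih =>
      exact ⟨(h (2 * k)).trans ih.1, (h (2 * k + 1)).trans ih.2⟩
  induction p generalizing i with
  | nil => trivial
  | cons c p ih =>
    obtain ⟨k, rfl⟩ : ∃ k, i = 2 * k := ⟨i / 2, by omega⟩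
    cases c <;> exact ⟨(hw k).1, (hw k).2, ih (2 * k + 2) (by omega)⟩

theorem not_avoidsPattern_of_alternating {w : ℕ → T} (h : ∀ i, w (i + 2) = w i) (anti : Bool)
    (p : List PatternLetter) : ¬ AvoidsPattern anti w p := by
  intro ha
  obtain ⟨σ, hσ, e⟩ := exists_letterAction_pair_eq anti (w 0) (w 1)
  refine ha σ hσ [w 0, w 1] (by simp) 0 ?_
  rw [e]
  exact occursAt_alternating h 0 p rfl

/-- `hT` says that there are at most two letters. A repeated letter together with its successor is
an instance under a transposition; without repeated letters the word alternates. -/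
theorem not_avoidsPattern_x_x_gx (hT : ∀ a b c : T, a ≠ b → b ≠ c → a = c) (anti : Bool)
    (w : ℕ → T) : ¬ AvoidsPattern anti w [.x, .x, .gx] := by
  classical
  by_cases hw : ∃ i, w i = w (i + 1)
  · obtain ⟨i, hi⟩ := hw
    intro h
    refine h (Equiv.swap (w i) (w (i + 2))) (fun a => Equiv.swap_apply_self _ _ a) [w i]
      (by simp) i ?_
    cases anti <;> simp [OccursAt, letterAction, ← hi]
  · push Not at hw
    exact not_avoidsPattern_of_alternating
      (fun i => (hT _ _ _ (hw i) (hw (i + 1))).symm) anti _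

theorem not_avoidsPattern_gx_x_x (hT : ∀ a b c : T, a ≠ b → b ≠ c → a = c) (anti : Bool)
    (w : ℕ → T) : ¬ AvoidsPattern anti w [.gx, .x, .x] := by
  classical
  by_cases hw : ∃ i, w (i + 1) = w (i + 2)
  · obtain ⟨i, hi⟩ := hw
    intro h
    refine h (Equiv.swap (w (i + 1)) (w i)) (fun a => Equiv.swap_apply_self _ _ a) [w (i + 1)]
      (by simp) i ?_
    cases anti <;> simp [OccursAt, letterAction, ← hi]
  · push Not at hw
    intro h
    -- Repetitions were only excluded from position 1 on, since `g(x)` needs a letter before `xx`;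
    -- hence only the tail is known to alternate.
    have halt : ∀ i, w (i + 1 + 2) = w (i + 1) :=
      fun i => (hT _ _ _ (hw i) (hw (i + 1))).symm
    refine not_avoidsPattern_of_alternating (w := fun i => w (i + 1))
      (fun i => halt i) anti [.gx, .x, .x] ?_
    intro σ hσ v hv i ho
    refine h σ hσ v hv (i + 1) ?_
    rw [occursAt_iff_getElem?] at ho ⊢
    intro k hk
    rw [ho k hk, add_right_comm]

theorem not_avoidsPattern_x_gx_x (hT : ∀ a b c : T, a ≠ b → b ≠ c → a = c) (anti : Bool)
    (w : ℕ → T) : ¬ AvoidsPattern anti w [.x, .gx, .x] := by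
  classical
  by_cases hw : ∃ i, w i = w (i + 2)
  · obtain ⟨i, hi⟩ := hw
    intro h
    refine h (Equiv.swap (w i) (w (i + 1))) (fun a => Equiv.swap_apply_self _ _ a) [w i]
      (by simp) i ?_
    cases anti <;> simp [OccursAt, letterAction, ← hi]
  · push Not at hw
    -- Letters at distance 2 always differ, so the word is a shift of `aabbaabb…`, and `aa bb aa` is
    -- an instance with `v = aa`.
    have h4 : ∀ i, w (i + 4) = w i := fun i => (hT _ _ _ (hw i) (hw (i + 2))).symm
    obtain ⟨i, hi⟩ : ∃ i, w i = w (i + 1) := by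
      by_cases h01 : w 0 = w 1
      · exact ⟨0, h01⟩
      · exact ⟨1, hT _ _ _ (Ne.symm h01) (hw 0)⟩
    have h23 : w (i + 2) = w (i + 3) :=
      hT _ _ _ (hw i).symm (fun e => hw (i + 1) (hi.symm.trans e))
    intro h
    refine h (Equiv.swap (w i) (w (i + 2))) (fun a => Equiv.swap_apply_self _ _ a) [w i, w i]
      (by simp) i ?_
    cases anti <;> simp [OccursAt, letterAction, ← hi, ← h23, h4, add_assoc]

end LowerBounds

/-! ### Avoidability of patterns by words over two and three letters -/

section UpperBounds

theorem ternaryWord_avoidsPattern_square (anti : Bool) :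
    AvoidsPattern anti ternaryWord [.x, .x] := by
  intro σ _ v hv i ho
  simp only [substPattern_x, substPattern_nil, List.append_nil, occursAt_append] at ho
  exact ternaryWord_square_free v.length (List.length_pos_of_ne_nil hv) i
    fun k hk => ho.1.periodic ho.2 hk

theorem thueMorse_avoidsPattern_cube (anti : Bool) :
    AvoidsPattern anti thueMorse [.x, .x, .x] := by
  intro σ _ v hv i ho
  have hpos := List.length_pos_of_ne_nil hv
  simp only [substPattern_x, substPattern_nil, List.append_nil, ← List.append_assoc] at ho
  exact thueMorse_overlap_free v.length hpos i
    fun k hk => ho.periodic_of_cube (by omega)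

/-- Some infinite word over `T` avoids `p` both morphically and antimorphically. -/
def AvoidableOver (T : Type*) (p : List PatternLetter) : Prop :=
  ∃ w : ℕ → T, ∀ anti, AvoidsPattern anti w p

theorem AvoidableOver.map_swap {T : Type*} {p : List PatternLetter} (h : AvoidableOver T p) :
    AvoidableOver T (p.map PatternLetter.swap) :=
  h.imp fun _ hw anti => (hw anti).map_swap

theorem AvoidableOver.of_infix {T : Type*} {p q : List PatternLetter} (h : AvoidableOver T q)
    (hqp : q <:+: p) : AvoidableOver T p :=
  h.imp fun _ hw anti => (hw anti).of_infix hqp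

theorem avoidableOver_bool_cube : AvoidableOver Bool [.x, .x, .x] :=
  ⟨_, thueMorse_avoidsPattern_cube⟩

/-- After a swap the pattern starts with `x`. Of the eight cases, three contain `xxx` or `ggg`; the
other five have their own words. -/
theorem avoidableOver_bool_of_four (a b c d : PatternLetter) :
    AvoidableOver Bool [a, b, c, d] := by
  wlog ha : a = .x generalizing a b c d
  · have := (this a.swap b.swap c.swap d.swap (by cases a <;> simp_all [PatternLetter.swap])).map_swap
    have hs : ∀ e : PatternLetter, e.swap.swap = e := fun e => by cases e <;> rfl
    simpa [hs] using this
  subst ha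
  cases b <;> cases c <;> cases d
  · exact avoidableOver_bool_cube.of_infix ⟨[], [.x], rfl⟩
  · exact avoidableOver_bool_cube.of_infix ⟨[], [.gx], rfl⟩
  · exact ⟨_, avoidsPattern_xxgx⟩
  · exact ⟨_, avoidsPattern_xxgg⟩
  · exact ⟨_, avoidsPattern_xgxx⟩
  · exact ⟨_, avoidsPattern_xgxg⟩
  · exact ⟨_, avoidsPattern_xggx⟩
  · exact avoidableOver_bool_cube.map_swap.of_infix ⟨[.x], [], rfl⟩

theorem avoidableOver_bool_of_four_le_length {p : List PatternLetter} (hp : 4 ≤ p.length) :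
    AvoidableOver Bool p := by
  obtain ⟨a, b, c, d, q, rfl⟩ : ∃ a b c d q, p = a :: b :: c :: d :: q := by
    match p, hp with
    | a :: b :: c :: d :: q, _ => exact ⟨a, b, c, d, q, rfl⟩
  exact (avoidableOver_bool_of_four a b c d).of_infix ⟨[], q, rfl⟩

theorem avoidableOver_ternary_square : AvoidableOver (Fin 3) [.x, .x] :=
  ⟨_, ternaryWord_avoidsPattern_square⟩

theorem avoidableOver_ternary_xgx : AvoidableOver (Fin 3) [.x, .gx, .x] :=
  ⟨_, avoidsPattern_xgx⟩

end UpperBounds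

/-! ### The avoidance indices -/

section Index

/-- The antimorphic (if `anti`) or morphic (otherwise) avoidance index. -/
noncomputable def avoidanceIndex (anti : Bool) (p : List PatternLetter) : ℕ∞ :=
  sInf {c : ℕ∞ | ∃ (T : Type) (_ : Fintype T) (w : ℕ → T),
    c = (Fintype.card T : ℕ∞) ∧ AvoidsPattern anti w p}

theorem morphicAvoidanceIndex_eq (p : UnaryPattern) :
    morphicAvoidanceIndex p = avoidanceIndex false p.toList := by
  simp only [morphicAvoidanceIndex, avoidanceIndex, avoidsPattern_false_iff]

theorem antimorphicAvoidanceIndex_eq (p : UnaryPattern) :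
    antimorphicAvoidanceIndex p = avoidanceIndex true p.toList := by
  simp only [antimorphicAvoidanceIndex, avoidanceIndex, avoidsPattern_true_iff]

theorem avoidanceIndex_eq_top {anti : Bool} {p : List PatternLetter}
    (h : ∀ (T : Type) (w : ℕ → T), ¬ AvoidsPattern anti w p) : avoidanceIndex anti p = ⊤ := by
  rw [avoidanceIndex, sInf_eq_top]
  rintro c ⟨T, _, w, -, hw⟩
  exact absurd hw (h T w)

theorem AvoidableOver.avoidanceIndex_le {T : Type} [Fintype T] {p : List PatternLetter}
    (h : AvoidableOver T p) (anti : Bool) : avoidanceIndex anti p ≤ Fintype.card T :=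
  sInf_le ⟨T, inferInstance, h.choose, rfl, h.choose_spec anti⟩

theorem two_le_avoidanceIndex (anti : Bool) (p : List PatternLetter) :
    2 ≤ avoidanceIndex anti p := by
  refine le_sInf ?_
  rintro c ⟨T, _, w, rfl, hw⟩
  by_contra hc
  have hc' : Fintype.card T < 2 := by exact_mod_cast not_le.mp hc
  have : Subsingleton T := Fintype.card_le_one_iff_subsingleton.mp (by omega)
  exact not_avoidsPattern_of_subsingleton anti w p hw

theorem three_le_avoidanceIndex {anti : Bool} {p : List PatternLetter}
    (h : ∀ (T : Type) (w : ℕ → T), (∀ a b c : T, a ≠ b → b ≠ c → a = c) →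
      ¬ AvoidsPattern anti w p) : 3 ≤ avoidanceIndex anti p := by
  refine le_sInf ?_
  rintro c ⟨T, _, w, rfl, hw⟩
  by_contra hc
  have hc' : Fintype.card T < 3 := by exact_mod_cast not_le.mp hc
  refine h T w (fun a b c hab hbc => ?_) hw
  by_contra hac
  have := Fintype.two_lt_card_iff.mpr ⟨a, b, c, hab, hac, hbc⟩
  omega

theorem avoidanceIndex_map_swap (anti : Bool) (p : List PatternLetter) :
    avoidanceIndex anti (p.map PatternLetter.swap) = avoidanceIndex anti p := by
  have : ∀ {T : Type} (w : ℕ → T),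
      AvoidsPattern anti w (p.map PatternLetter.swap) ↔ AvoidsPattern anti w p := by
    intro T w
    refine ⟨fun h => ?_, fun h => h.map_swap⟩
    have hs : PatternLetter.swap ∘ PatternLetter.swap = id :=
      funext fun e => by cases e <;> rfl
    simpa [hs] using h.map_swap
  simp only [avoidanceIndex, this]

theorem avoidanceIndex_eq_two {p : List PatternLetter} (h : AvoidableOver Bool p) (anti : Bool) :
    avoidanceIndex anti p = 2 :=
  le_antisymm (by simpa using h.avoidanceIndex_le anti) (two_le_avoidanceIndex anti p)

theorem avoidanceIndex_of_four_le_or_cube {p : List PatternLetter}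
    (hp : 4 ≤ p.length ∨ p = [.x, .x, .x] ∨ p = [.gx, .gx, .gx]) (anti : Bool) :
    avoidanceIndex anti p = 2 := by
  refine avoidanceIndex_eq_two ?_ anti
  rcases hp with hp | rfl | rfl
  · exact avoidableOver_bool_of_four_le_length hp
  · exact avoidableOver_bool_cube
  · exact avoidableOver_bool_cube.map_swap

theorem avoidanceIndex_unavoidable {p : List PatternLetter}
    (hp : p ∈ [[.x], [.gx], [.x, .gx], [.gx, .x]]) (anti : Bool) : avoidanceIndex anti p = ⊤ := by
  have h1 : avoidanceIndex anti [.x] = ⊤ :=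
    avoidanceIndex_eq_top fun _ w => not_avoidsPattern_single anti w
  have h2 : avoidanceIndex anti [.x, .gx] = ⊤ :=
    avoidanceIndex_eq_top fun _ w => not_avoidsPattern_x_gx anti w
  simp only [List.mem_cons, List.not_mem_nil, or_false] at hp
  rcases hp with rfl | rfl | rfl | rfl
  · exact h1
  · exact (avoidanceIndex_map_swap anti [.x]).trans h1
  · exact h2
  · exact (avoidanceIndex_map_swap anti [.x, .gx]).trans h2

theorem avoidanceIndex_eq_three {p : List PatternLetter} {anti : Bool}
    (h : AvoidableOver (Fin 3) p)
    (h' : ∀ (T : Type) (w : ℕ → T), (∀ a b c : T, a ≠ b → b ≠ c → a = c) →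
      ¬ AvoidsPattern anti w p) : avoidanceIndex anti p = 3 :=
  le_antisymm (by simpa using h.avoidanceIndex_le anti) (three_le_avoidanceIndex h')

theorem avoidanceIndex_indexThree {p : List PatternLetter}
    (hp : p ∈ [[.x, .x], [.gx, .gx], [.x, .x, .gx], [.gx, .gx, .x], [.gx, .x, .x], [.x, .gx, .gx],
      [.x, .gx, .x], [.gx, .x, .gx]]) (anti : Bool) : avoidanceIndex anti p = 3 := by
  -- A word avoiding `xx` also avoids `xxg`, so the lower bound for `xxg` carries over.
  have h1 : avoidanceIndex anti [.x, .x] = 3 :=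
    avoidanceIndex_eq_three avoidableOver_ternary_square fun _ w hT h =>
      not_avoidsPattern_x_x_gx hT anti w (h.of_infix ⟨[], [.gx], rfl⟩)
  have h2 : avoidanceIndex anti [.x, .x, .gx] = 3 :=
    avoidanceIndex_eq_three (avoidableOver_ternary_square.of_infix ⟨[], [.gx], rfl⟩)
      fun _ w hT => not_avoidsPattern_x_x_gx hT anti w
  have h3 : avoidanceIndex anti [.gx, .x, .x] = 3 :=
    avoidanceIndex_eq_three (avoidableOver_ternary_square.of_infix ⟨[.gx], [], rfl⟩)
      fun _ w hT => not_avoidsPattern_gx_x_x hT anti w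
  have h4 : avoidanceIndex anti [.x, .gx, .x] = 3 :=
    avoidanceIndex_eq_three avoidableOver_ternary_xgx
      fun _ w hT => not_avoidsPattern_x_gx_x hT anti w
  simp only [List.mem_cons, List.not_mem_nil, or_false] at hp
  rcases hp with rfl | rfl | rfl | rfl | rfl | rfl | rfl | rfl
  · exact h1
  · exact (avoidanceIndex_map_swap anti [.x, .x]).trans h1
  · exact h2
  · exact (avoidanceIndex_map_swap anti [.x, .x, .gx]).trans h2
  · exact h3
  · exact (avoidanceIndex_map_swap anti [.gx, .x, .x]).trans h3
  · exact h4
  · exact (avoidanceIndex_map_swap anti [.x, .gx, .x]).trans h4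

namespace UnaryPattern

theorem mem_unavoidable_iff {p : UnaryPattern} :
    p ∈ unavoidable ↔ p.toList ∈ [[.x], [.gx], [.x, .gx], [.gx, .x]] := by
  simp only [unavoidable, Set.mem_insert_iff, Set.mem_singleton_iff, List.mem_cons,
    List.not_mem_nil, or_false]
  rfl

theorem mem_indexThree_iff {p : UnaryPattern} :
    p ∈ indexThree ↔ p.toList ∈ [[.x, .x], [.gx, .gx], [.x, .x, .gx], [.gx, .gx, .x],
      [.gx, .x, .x], [.x, .gx, .gx], [.x, .gx, .x], [.gx, .x, .gx]] := by
  have h : p ∈ indexThree ↔ (p.toList.length = 3 ∧ p.toList ≠ [.x, .x, .x] ∧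
      p.toList ≠ [.gx, .gx, .gx]) ∨ p.toList = [.x, .x] ∨ p.toList = [.gx, .gx] := Iff.rfl
  rw [h]
  generalize p.toList = q
  rcases q with _ | ⟨a, _ | ⟨b, _ | ⟨c, _ | ⟨d, q⟩⟩⟩⟩
  · simp
  · simp
  · cases a <;> cases b <;> simp
  · cases a <;> cases b <;> cases c <;> simp
  · simp

theorem four_le_or_cube {p : UnaryPattern} (hp : p ≠ 1) (h3 : p ∉ indexThree)
    (hu : p ∉ unavoidable) :
    4 ≤ p.toList.length ∨ p.toList = [.x, .x, .x] ∨ p.toList = [.gx, .gx, .gx] := by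
  rw [mem_indexThree_iff] at h3
  rw [mem_unavoidable_iff] at hu
  have hp' : p.toList ≠ [] := hp
  generalize p.toList = q at *
  rcases q with _ | ⟨a, _ | ⟨b, _ | ⟨c, _ | ⟨d, q⟩⟩⟩⟩
  · exact absurd rfl hp'
  · cases a <;> simp at hu
  · cases a <;> cases b <;> simp at hu h3
  · cases a <;> cases b <;> cases c <;> simp at h3 ⊢
  · simp

end UnaryPattern

end Index

theorem mainTheorem1 (p : UnaryPattern) (hp : p ≠ 1) :
    morphicAvoidanceIndex p = antimorphicAvoidanceIndex p ∧
    (p ∈ UnaryPattern.indexThree →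
      morphicAvoidanceIndex p = 3 ∧ antimorphicAvoidanceIndex p = 3) ∧
    (p ∈ UnaryPattern.unavoidable →
      morphicAvoidanceIndex p = ⊤ ∧ antimorphicAvoidanceIndex p = ⊤) ∧
    (p ∉ UnaryPattern.indexThree → p ∉ UnaryPattern.unavoidable →
      morphicAvoidanceIndex p = 2 ∧ antimorphicAvoidanceIndex p = 2) ∧
    ((4 ≤ p.length ∨ p = UnaryPattern.X * UnaryPattern.X * UnaryPattern.X ∨
        p = UnaryPattern.G * UnaryPattern.G * UnaryPattern.G) →
      morphicAvoidanceIndex p = 2 ∧ antimorphicAvoidanceIndex p = 2) := by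
  rw [morphicAvoidanceIndex_eq, antimorphicAvoidanceIndex_eq]
  have h3 : p ∈ UnaryPattern.indexThree → ∀ anti, avoidanceIndex anti p.toList = 3 :=
    fun h => avoidanceIndex_indexThree (UnaryPattern.mem_indexThree_iff.mp h)
  have hu : p ∈ UnaryPattern.unavoidable → ∀ anti, avoidanceIndex anti p.toList = ⊤ :=
    fun h => avoidanceIndex_unavoidable (UnaryPattern.mem_unavoidable_iff.mp h)
  have h2 : p ∉ UnaryPattern.indexThree → p ∉ UnaryPattern.unavoidable →
      ∀ anti, avoidanceIndex anti p.toList = 2 :=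
    fun h h' => avoidanceIndex_of_four_le_or_cube (UnaryPattern.four_le_or_cube hp h h')
  refine ⟨?_, fun h => ⟨h3 h _, h3 h _⟩, fun h => ⟨hu h _, hu h _⟩,
    fun h h' => ⟨h2 h h' _, h2 h h' _⟩, fun h => ?_⟩
  · by_cases h : p ∈ UnaryPattern.indexThree
    · rw [h3 h, h3 h]
    · by_cases h' : p ∈ UnaryPattern.unavoidable
      · rw [hu h', hu h']
      · rw [h2 h h', h2 h h']
  · exact ⟨avoidanceIndex_of_four_le_or_cube h _, avoidanceIndex_of_four_le_or_cube h _⟩
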